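/- Let $p\ge 1$ be an integer and let $T_{p,p+1}\subset S^3$ be the positive $(p,p+1)$-torus knot, i.e. the closure of the $p$-strand braid $(\sigma_1\sigma_2\cdots\sigma_{p-1})^{p+1}$. Let $$\Delta_{T_{p,p+1}}(t)=a_0(p)+\sum_{i=1}^{n_p}a_i(p)\,(t^i+t^{-i})\in\mathbb Z[t,t^{-1}]$$ be its symmetrized Alexander polynomial, i.e. the unique generator $\Delta$ of the first elementary ideal of the Alexander matrix of the knot group (for instance of its Wirtinger presentation) with $\Delta(t^{-1})=\Delta(t)$ and $\Delta(1)=1$; put $a_{-i}(p)=a_i(p)$, and $a_i(p)=0$ for $i>n_p$. Then: (i) $a_0(p)=(-1)^{p+1}$; (ii) every nonzero coefficient $a_i(p)$ is $\pm1$, and the nonzero coefficients alternate in sign, i.e. if $i<j$ are integers with $a_i(p)\ne 0$, $a_j(p)\neq 0$ and $a_k(p)=0$ for all $i<k<j$, then $a_j(p)=-a_i(p)$; (iii) $a_i(p)=0$ for all integers $i$ with $0<i<\frac p2$. -/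

import Mathlib

open scoped LaurentPolynomial

/-! ### Fox calculus and the Alexander polynomial of a presentation -/

/-- The Fox derivative with respect to the generator `x` of a word in the letters `y`
(written `(y, true)`) and `y⁻¹` (written `(y, false)`), with its value pushed to `ℤ[T;T⁻¹]` by
the homomorphism that sends every generator to `T`. It is determined by
`∂(y · w) = ∂y + T ∂w`, `∂(y⁻¹ · w) = - T⁻¹ ∂y + T⁻¹ ∂w`, where `∂y = 1` if `y = x` and
`∂y = 0` otherwise. -/
noncomputable def foxDerivative {ι : Type*} [DecidableEq ι] (x : ι) :
    List (ι × Bool) → ℤ[T;T⁻¹]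
  | [] => 0
  | (y, true) :: w => (if y = x then 1 else 0) + LaurentPolynomial.T 1 * foxDerivative x w
  | (y, false) :: w =>
      (if y = x then - LaurentPolynomial.T (-1) else 0)
        + LaurentPolynomial.T (-1) * foxDerivative x w

/-- The Alexander matrix (abelianized Fox Jacobian) of a group presentation with generators `ι`
and relators `r k`, for `k : κ`. -/
noncomputable def alexanderMatrix {ι κ : Type*} [DecidableEq ι] (r : κ → List (ι × Bool)) :
    Matrix κ ι ℤ[T;T⁻¹] :=
  Matrix.of fun k x => foxDerivative x (r k)

/-- The first elementary ideal of a matrix: the ideal generated by its minors whose size is one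
less than the number of columns. -/
def firstElementaryIdeal {ι κ R : Type*} [Fintype ι] [CommRing R] (A : Matrix κ ι R) : Ideal R :=
  Ideal.span {d | ∃ (f : Fin (Fintype.card ι - 1) → κ) (g : Fin (Fintype.card ι - 1) → ι),
    d = (A.submatrix f g).det}

/-! ### Closed braids and torus knots -/

/-- A braid word on `n` strands: a list of letters `(i, ε)`, standing for `σᵢ` if `ε = true` and
for `σᵢ⁻¹` if `ε = false`, where `σᵢ` involves the strands in the adjacent positions `i` and
`i + 1` (positions are counted from `0`). -/
abbrev BraidWord (n : ℕ) := List (Fin (n - 1) × Bool)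

/-- The braid `(σ₀ σ₁ ⋯ σ_{p-2})^q` on `p` strands, whose closure is the positive torus link
`T_{p,q}`. -/
def torusBraid (p q : ℕ) : BraidWord p :=
  (List.replicate q ((List.finRange (p - 1)).map fun i => (i, true))).flatten

namespace BraidWord

/-- The edges of the standard diagram of the closure of `β`. The strands run upwards, the `k`-th
letter of `β` is a crossing between the heights `k` and `k + 1`, and `(k, i)` is the piece of
strand at height `k` in position `i`, for `0 ≤ k ≤ length of β`. -/
abbrev Edge {n : ℕ} (β : BraidWord n) := Fin (β.length + 1) × Fin n

/-- The Wirtinger relators of the standard diagram of the closure of `β`; the generators are the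
meridians of the edges.

Let `a`, `b` be the lower left and lower right edges and `c`, `d` the upper left and upper
right edges at a crossing. At a positive crossing `σᵢ` the over-strand goes from `a` to `d` and the
relations are `d = a` and `c = a b a⁻¹`; at a negative crossing `σᵢ⁻¹` the over-strand goes from
`b` to `c` and the relations are `c = b` and `d = b⁻¹ a b`. A strand which is not involved
in the `k`-th crossing gives the relation `(k + 1, i) = (k, i)`. The last relations join the top
end of the braid to its bottom end in each position. -/
def wirtingerRelator {n : ℕ} (β : BraidWord n) : β.Edge → List (β.Edge × Bool) := fun e =>
  if hk : (e.1 : ℕ) < β.length then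
    let j : ℕ := (β[(e.1 : ℕ)]).1
    have hj : j < n - 1 := (β[(e.1 : ℕ)]).1.isLt
    let a : β.Edge := (e.1, ⟨j, by omega⟩)
    let b : β.Edge := (e.1, ⟨j + 1, by omega⟩)
    let up : β.Edge := (⟨(e.1 : ℕ) + 1, by omega⟩, e.2)
    if (e.2 : ℕ) = j then
      if (β[(e.1 : ℕ)]).2 then [(a, true), (b, true), (a, false), (up, false)]
      else [(b, true), (up, false)]
    else if (e.2 : ℕ) = j + 1 then
      if (β[(e.1 : ℕ)]).2 then [(a, true), (up, false)]
      else [(b, false), (a, true), (b, true), (up, false)]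
    else [(e, true), (up, false)]
  else [(e, true), ((0, e.2), false)]

/-- `Δ` is the symmetrized Alexander polynomial of the closure of the braid `β` (when this closure
is a knot): it generates the first elementary ideal of the Alexander matrix of the Wirtinger
presentation of the knot group, and it is normalized by `Δ(t⁻¹) = Δ(t)` and `Δ(1) = 1`. -/
def IsSymmetrizedAlexanderPolynomial {n : ℕ} (β : BraidWord n) (Δ : ℤ[T;T⁻¹]) : Prop :=
  firstElementaryIdeal (alexanderMatrix β.wirtingerRelator) = Ideal.span {Δ} ∧
    LaurentPolynomial.invert Δ = Δ ∧
    LaurentPolynomial.eval₂ (RingHom.id ℤ) 1 Δ = 1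

end BraidWord

/-!
The closure of a positive braid `β` with `n` strands has, level by level, the relations
`x_{k+1} = M_k x_k` (`M_k` a Burau matrix) together with the closing relation `x_L = x_0`, so its
Alexander matrix `A` is the block matrix of a cyclic linear system
(`alexanderMatrix_wirtingerRelator`). It is singular on both sides: it kills the vector `1`, and it
is killed from the left by the vector `w` whose entry at a meridian in position `i` is `t ^ i`.
Hence, by Cramer's rule, the adjugate of `A` has the form `c 1 wᵀ`. The entries of the adjugate
generate the first elementary ideal of a square matrix, and those of `w` are units, so this ideal
is `(c)`.

The element `c` is read off from a rank one perturbation: `det (A + u vᵀ) = c (w · u) (1 · v)`. A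
perturbation in the first block turns this determinant, after elimination, into that of
`B + 1 vᵀ - 1`, where `B` is the Burau matrix of the whole braid
(`exists_firstElementaryIdeal_eq_span`). For the braid `(σ₀ ⋯ σ_{p-2})^q`, one round acts as `t`
times the cyclic shift `S` of the strands up to a matrix `1 rᵀ`, hence `B = t ^ q S ^ q + 1 rᵀ`
for some `r`, with entries summing to `1 - t ^ q` because `B 1 = 1`. For `q = p + 1` we have
`S ^ q = S`, and the choice `v = -r` leaves `det (t ^ q S - 1) ≐ t ^ (p q) - 1`. This is the
classical formula `c (1 + t + ⋯ + t ^ (p - 1)) (t ^ q - 1) ≐ t ^ (p q) - 1`.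

Finally, for `q = p + 1`, the quotient is
`∑_{k < p} t ^ (k p) - ∑_{k < p - 1} t ^ (k (p + 1) + 1)`, by telescoping (`geom_sum_sub_mul_eq`).
The exponents interlace, since `k p < k (p + 1) + 1 < (k + 1) p` for `k < p - 1`. Centred by the
genus `p (p - 1) / 2`, the double of each exponent is a multiple of `p` (for the positive terms) or
of `p + 1` (for the negative terms), which gives the gap around the middle coefficient. The
normalization determines the generator because the units of `ℤ[T;T⁻¹]` are the `±T ^ n`.
In Lean `p` is written `n + 1`.
-/

/-! ### Elementary ideals and adjugates -/

section LinearAlgebra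

open Matrix

variable {R : Type*} [CommRing R]

lemma adjugate_mem_firstElementaryIdeal {ι : Type*} [Fintype ι] [DecidableEq ι]
    (A : Matrix ι ι R) (i j : ι) : A.adjugate i j ∈ firstElementaryIdeal A := by
  obtain ⟨m, hm⟩ : ∃ m, Fintype.card ι = m + 1 :=
    Nat.exists_eq_succ_of_ne_zero (Fintype.card_pos_iff.2 ⟨i⟩).ne'
  let e : ι ≃ Fin (m + 1) := Fintype.equivFinOfCardEq hm
  have h := adjugate_reindex e A
  have h1 : A.adjugate i j = (reindex e e A).adjugate (e i) (e j) := by rw [h]; simp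
  rw [h1, adjugate_fin_succ_eq_det_submatrix]
  refine Ideal.mul_mem_left _ _ (Ideal.subset_span ?_)
  have hm' : Fintype.card ι - 1 = m := by omega
  refine ⟨fun x => e.symm ((e j).succAbove (Fin.cast hm' x)),
    fun x => e.symm ((e i).succAbove (Fin.cast hm' x)), ?_⟩
  rw [← det_submatrix_equiv_self (finCongr hm')]
  rfl

/-- A minor of size `m` of a square matrix of size `m + 1` is zero if it repeats a row or a column,
and is an entry of the adjugate up to sign otherwise. -/
lemma det_submatrix_mem_span_adjugate {m : ℕ} (A : Matrix (Fin (m + 1)) (Fin (m + 1)) R)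
    (f g : Fin m → Fin (m + 1)) :
    (A.submatrix f g).det ∈ Ideal.span {d | ∃ i j, d = A.adjugate i j} := by
  by_cases hf : Function.Injective f
  swap
  · obtain ⟨a, b, hab, hne⟩ : ∃ a b, f a = f b ∧ a ≠ b := by
      simpa [Function.Injective] using hf
    rw [det_zero_of_row_eq hne (by ext; simp [hab])]
    exact zero_mem _
  by_cases hg : Function.Injective g
  swap
  · obtain ⟨a, b, hab, hne⟩ : ∃ a b, g a = g b ∧ a ≠ b := by
      simpa [Function.Injective] using hg
    rw [det_zero_of_column_eq hne (by intro; simp [hab])]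
    exact zero_mem _
  have key : ∀ f : Fin m → Fin (m + 1), Function.Injective f →
      ∃ (i : Fin (m + 1)) (σ : Equiv.Perm (Fin m)), f = i.succAbove ∘ σ := by
    intro f hf
    obtain ⟨i, hi⟩ : ∃ i, ∀ x, f x ≠ i := by
      by_contra! h
      have := Fintype.card_le_of_surjective f h
      simp at this
    choose s hs using fun x => Fin.exists_succAbove_eq (hi x)
    have hinj : Function.Injective s := fun a b hab => hf (by rw [← hs a, ← hs b, hab])
    exact ⟨i, Equiv.ofBijective s (Finite.injective_iff_bijective.1 hinj), by
      ext x; simp [hs]⟩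
  obtain ⟨j, σ, rfl⟩ := key f hf
  obtain ⟨i, τ, rfl⟩ := key g hg
  have h1 : A.submatrix (j.succAbove ∘ σ) (i.succAbove ∘ τ)
      = ((A.submatrix j.succAbove i.succAbove).submatrix σ id).submatrix id τ := by
    ext; simp
  have h2 : (A.submatrix j.succAbove i.succAbove).det
      = (-1) ^ (j + i : ℕ) * A.adjugate i j := by
    rw [adjugate_fin_succ_eq_det_submatrix, ← mul_assoc, ← pow_add, Even.neg_one_pow ⟨_, rfl⟩,
      one_mul]
  rw [h1, det_permute', det_permute, h2]
  exact Ideal.mul_mem_left _ _ (Ideal.mul_mem_left _ _ (Ideal.mul_mem_left _ _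
    (Ideal.subset_span ⟨i, j, rfl⟩)))

/-- The first elementary ideal of a square matrix is generated by the entries of the adjugate. -/
lemma firstElementaryIdeal_eq_span_adjugate {ι : Type*} [Fintype ι] [DecidableEq ι] [Nonempty ι]
    (A : Matrix ι ι R) :
    firstElementaryIdeal A = Ideal.span {d | ∃ i j, d = A.adjugate i j} := by
  apply le_antisymm
  · refine Ideal.span_le.2 ?_
    rintro _ ⟨f, g, rfl⟩
    obtain ⟨m, hm⟩ : ∃ m, Fintype.card ι = m + 1 :=
      Nat.exists_eq_succ_of_ne_zero Fintype.card_pos.ne'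
    let e : ι ≃ Fin (m + 1) := Fintype.equivFinOfCardEq hm
    have hm' : m = Fintype.card ι - 1 := by omega
    have h := det_submatrix_mem_span_adjugate (reindex e e A)
      (fun x => e (f (Fin.cast hm' x))) (fun x => e (g (Fin.cast hm' x)))
    have h1 : (reindex e e A).submatrix (fun x => e (f (Fin.cast hm' x)))
        (fun x => e (g (Fin.cast hm' x)))
        = (A.submatrix f g).submatrix (finCongr hm') (finCongr hm') := by
      ext; simp
    rw [h1, det_submatrix_equiv_self] at h
    refine Ideal.span_mono ?_ h
    rintro _ ⟨i, j, rfl⟩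
    exact ⟨e.symm i, e.symm j, by rw [adjugate_reindex]; simp⟩
  · refine Ideal.span_le.2 ?_
    rintro _ ⟨i, j, rfl⟩
    exact adjugate_mem_firstElementaryIdeal A i j

variable {ι : Type*} [Fintype ι] [DecidableEq ι]

/-- Cramer's rule applied to `A` with row `j` replaced by a unit vector: each column of the adjugate
is proportional to every vector in the kernel. -/
lemma adjugate_mul_eq_of_mulVec_eq_zero {A : Matrix ι ι R} {x : ι → R} (hx : A *ᵥ x = 0)
    (i k j : ι) : A.adjugate i j * x k = A.adjugate k j * x i := by
  set A' := A.updateRow j (Pi.single i 1) with hA'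
  have h1 : A' *ᵥ x = Pi.single j (x i) := by
    ext l
    by_cases hl : l = j
    · subst hl; simp [hA', mulVec]
    · have := congrFun hx l
      simpa [hA', mulVec, hl] using this
  have h2 : A'.det * x k = A'.adjugate k j * x i := by
    have := congrFun (congrArg (fun v => A'.adjugate *ᵥ v) h1) k
    simpa [mulVec_mulVec, adjugate_mul, smul_mulVec] using this
  have h3 : A'.adjugate k j = A.adjugate k j := by
    rw [adjugate_apply, adjugate_apply, hA', updateRow_idem]
  rw [h3, hA', ← adjugate_apply] at h2
  exact h2

lemma adjugate_mul_eq_of_vecMul_eq_zero {A : Matrix ι ι R} {w : ι → R} (hw : w ᵥ* A = 0)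
    (i j l : ι) : A.adjugate i j * w l = A.adjugate i l * w j := by
  have h := adjugate_mul_eq_of_mulVec_eq_zero (A := Aᵀ) (x := w) (by rwa [mulVec_transpose]) j l i
  simpa [← adjugate_transpose] using h

/-- If the rows of `A` add up to zero with weights `w` that are units, and so do the columns with
weights `1`, then all the entries of the adjugate agree up to units. -/
lemma firstElementaryIdeal_eq_span_singleton {A : Matrix ι ι R} {w : ι → R}
    (hA : A *ᵥ 1 = 0) (hw : w ᵥ* A = 0) (hu : ∀ j, IsUnit (w j)) (i j : ι) :
    firstElementaryIdeal A = Ideal.span {A.adjugate i j} := by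
  have : Nonempty ι := ⟨i⟩
  rw [firstElementaryIdeal_eq_span_adjugate]
  apply le_antisymm
  · refine Ideal.span_le.2 ?_
    rintro _ ⟨k, l, rfl⟩
    have h1 := adjugate_mul_eq_of_mulVec_eq_zero hA k i l
    have h2 := adjugate_mul_eq_of_vecMul_eq_zero hw i j l
    simp only [Pi.one_apply, mul_one] at h1
    rw [h1, SetLike.mem_coe, ← Ideal.mul_unit_mem_iff_mem _ (hu j), ← h2]
    exact Ideal.mul_mem_right _ _ (Ideal.mem_span_singleton_self _)
  · exact Ideal.span_mono (by rintro _ rfl; exact ⟨i, j, rfl⟩)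

/-- The effect of a rank one perturbation on the determinant of a singular matrix whose left
and right kernels contain `w` and `1`. -/
lemma det_add_vecMulVec_of_kernels {A : Matrix ι ι R} {w : ι → R}
    (hA : A *ᵥ 1 = 0) (hw : w ᵥ* A = 0) (i j : ι) (hj : w j = 1) (u v : ι → R) :
    (A + vecMulVec u v).det = A.adjugate i j * ((w ⬝ᵥ u) * ∑ k, v k) := by
  set A' := A + vecMulVec u v with hA'
  have h1 : ∑ k, w k • A' k = (w ⬝ᵥ u) • v := by
    ext l
    have hl : ∑ k, w k * A k l = 0 := congrFun hw l
    simp [hA', vecMulVec_apply, Finset.sum_apply, mul_add, Finset.sum_add_distrib, hl,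
      dotProduct, Finset.sum_mul, mul_assoc]
  -- The combination of the rows with weights `w` is a multiple of `v`, and can replace row `j`.
  have h2 : A'.det = (w ⬝ᵥ u) * (A'.updateRow j v).det := by
    have := det_updateRow_sum A' j w
    rw [h1, hj, one_smul, det_updateRow_smul] at this
    exact this.symm
  have h3 : (A'.updateRow j v).det = (A.updateRow j v).det := by
    refine det_eq_of_forall_row_eq_smul_add_const (Function.update u j 0) j (by simp) ?_
    intro k l
    by_cases hk : k = j
    · subst hk; simp
    · simp [hk, hA', vecMulVec_apply]
  have h4 : (A.updateRow j v).det = ∑ k, v k * A.adjugate k j := by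
    rw [← cramer_transpose_apply, cramer_eq_adjugate_mulVec, ← adjugate_transpose,
      mulVec_transpose, vecMul, dotProduct]
  have h5 : ∀ k, A.adjugate k j = A.adjugate i j := fun k => by
    simpa using adjugate_mul_eq_of_mulVec_eq_zero hA k i j
  rw [h2, h3, h4]
  simp only [h5, ← Finset.sum_mul]
  ring

/-! ### Cyclic block matrices -/

variable {n : Type*} [Fintype n] [DecidableEq n]

lemma det_comp_of_lower {m : ℕ} (M : Matrix (Fin m) (Fin m) (Matrix n n R))
    (hM : ∀ i j, i < j → M i j = 0) :
    (comp _ _ _ _ R M).det = ∏ k, (M k k).det := by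
  have hb : (comp _ _ _ _ R M).BlockTriangular (fun x => OrderDual.toDual x.1) := by
    rintro ⟨i, a⟩ ⟨j, b⟩ h
    have h' : i < j := h
    simp [hM i j h']
  rw [hb.det_fintype, ← OrderDual.toDual.prod_comp]
  refine Finset.prod_congr rfl fun k _ => ?_
  let e : n ≃ {x : Fin m × n // OrderDual.toDual x.1 = OrderDual.toDual k} :=
    { toFun := fun a => ⟨(k, a), rfl⟩
      invFun := fun x => x.1.2
      left_inv := fun _ => rfl
      right_inv := by rintro ⟨⟨a, b⟩, h⟩; have : a = k := h; subst this; rfl }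
  rw [← det_submatrix_equiv_self e]
  rfl

/-- The block matrix of the cyclic system `m 0 x₀ = x₁, m 1 x₁ = x₂, …, m L x_L = x₀`. -/
def cyclicMatrix {A : Type*} [Ring A] {L : ℕ} (m : Fin (L + 1) → A) :
    Matrix (Fin (L + 1)) (Fin (L + 1)) A :=
  of fun k k' => (if k' = k then m k else 0) - (if k' = k + 1 then 1 else 0)

lemma comp_cyclicMatrix_apply {L : ℕ} (m : Fin (L + 1) → Matrix n n R) (k k' : Fin (L + 1))
    (i i' : n) : comp _ _ _ _ R (cyclicMatrix m) (k, i) (k', i')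
      = (if k' = k then m k i i' else 0) - (if k' = k + 1 ∧ i = i' then 1 else 0) := by
  simp only [comp_apply, cyclicMatrix, of_apply, Matrix.sub_apply, ite_and]
  congr 1
  · split_ifs <;> rfl
  · split_ifs <;> simp_all [Matrix.one_apply]

/-- Eliminating `x₁, …, x_L` from a cyclic system leaves `m L ⋯ m 0 x₀ = x₀`. The partial
products `m L ⋯ m k` are given as `N k`. -/
lemma associated_det_cyclicMatrix {L : ℕ} (m : Fin (L + 1) → Matrix n n R)
    (N : ℕ → Matrix n n R) (hN : ∀ k : Fin (L + 1), N k = N (k + 1) * m k) (hL : N (L + 1) = 1) :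
    Associated (comp _ _ _ _ R (cyclicMatrix m)).det (N 0 - 1).det := by
  -- Left multiplication by `U` replaces the last row by the sum of the rows with weights
  -- `m L ⋯ m (k + 1)`, which telescopes to `(m L ⋯ m 0 - 1) x₀`.
  let U : Matrix (Fin (L + 1)) (Fin (L + 1)) (Matrix n n R) :=
    of fun k k' => if k = Fin.last L then N (k' + 1) else if k' = k then 1 else 0
  have hU : (comp _ _ _ _ R U).det = 1 := by
    rw [det_comp_of_lower]
    · refine Finset.prod_eq_one fun k _ => ?_
      by_cases hk : k = Fin.last L
      · subst hk; simp [U, hL]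
      · simp [U, hk]
    · intro i j hij
      have h1 : i ≠ Fin.last L := (lt_of_lt_of_le hij (Fin.le_last j)).ne
      simp [U, h1, hij.ne']
  have hsucc : ∀ k k' : Fin (L + 1), k' = k + 1 ↔ k = k' - 1 := fun k k' => by
    rw [eq_sub_iff_add_eq, eq_comm]
  have hUX : U * cyclicMatrix m = of fun k k' =>
      if k = Fin.last L then (if k' = 0 then N 0 - 1 else 0) else cyclicMatrix m k k' := by
    ext1 k k'
    rw [mul_apply]
    by_cases hk : k = Fin.last L
    · simp only [U, cyclicMatrix, of_apply, hk, if_true, mul_sub, Finset.sum_sub_distrib, mul_ite,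
        mul_zero, mul_one, hsucc, Finset.sum_ite_eq, Finset.sum_ite_eq', Finset.mem_univ]
      rw [← hN]
      by_cases h0 : k' = 0
      · subst h0
        simp [hL]
      · have : ((k' - 1 : Fin (L + 1)) : ℕ) + 1 = k' := by
          have h1 : (k' : ℕ) ≠ 0 := fun h => h0 (Fin.ext h)
          rw [Fin.val_sub_one_of_ne_zero h0]; omega
        simp [this, h0]
    · simp [U, hk]
  have hdet : (comp _ _ _ _ R (U * cyclicMatrix m)).det
      = (comp _ _ _ _ R (cyclicMatrix m)).det := by
    have := (compRingEquiv (Fin (L + 1)) n R).map_mul U (cyclicMatrix m)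
    simp only [compRingEquiv_apply] at this
    rw [this, det_mul, hU, one_mul]
  -- Moving the last row to the top makes the matrix lower triangular.
  let σ : Equiv.Perm (Fin (L + 1)) := Equiv.subRight 1
  have hent : ∀ i j, (U * cyclicMatrix m).submatrix σ id i j
      = if i = 0 then (if j = 0 then N 0 - 1 else 0)
        else (if j = i - 1 then m (i - 1) else 0) - (if j = i then 1 else 0) := fun i j => by
    have hlast : i - 1 = Fin.last L ↔ i = 0 := by rw [sub_eq_iff_eq_add, Fin.last_add_one]
    rw [hUX]
    simp only [submatrix_apply, of_apply, σ, Equiv.subRight_apply, hlast, id_eq, cyclicMatrix,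
      sub_add_cancel]
  have hperm : (comp _ _ _ _ R ((U * cyclicMatrix m).submatrix σ id)).det
      = (N 0 - 1).det * ∏ k : Fin L, (-1 : Matrix n n R).det := by
    have hpred : ∀ i j : Fin (L + 1), i ≠ 0 → i ≤ j → j ≠ i - 1 := fun i j hi hij h => by
      have h1 : (j : ℕ) = i - 1 := by rw [h, Fin.val_sub_one_of_ne_zero hi]
      have h2 : (i : ℕ) ≠ 0 := fun h => hi (Fin.ext h)
      have h3 : (i : ℕ) ≤ j := hij
      omega
    rw [det_comp_of_lower, Fin.prod_univ_succ]
    · congr 1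
      · rw [hent, if_pos rfl, if_pos rfl]
      · refine Finset.prod_congr rfl fun k _ => ?_
        rw [hent, if_neg (Fin.succ_ne_zero k), if_neg (hpred _ _ (Fin.succ_ne_zero k) le_rfl),
          if_pos rfl, zero_sub]
    · intro i j hij
      rw [hent]
      by_cases hi : i = 0
      · rw [if_pos hi, if_neg (hi ▸ hij.ne')]
      · rw [if_neg hi, if_neg (hpred i j hi hij.le), if_neg hij.ne', sub_zero]
  have hsign : (comp _ _ _ _ R ((U * cyclicMatrix m).submatrix σ id)).det
      = (Equiv.Perm.sign (σ.prodCongr (Equiv.refl n)) : ℤ)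
        * (comp _ _ _ _ R (cyclicMatrix m)).det := by
    rw [← hdet, ← det_permute]
    rfl
  have hs : IsUnit ((Equiv.Perm.sign (σ.prodCongr (Equiv.refl n)) : ℤ) : R) :=
    (Units.isUnit _).map (Int.castRingHom R)
  have hm : IsUnit (∏ k : Fin L, (-1 : Matrix n n R).det) := by
    refine (IsUnit.prod_univ_iff (M := R)).2 fun _ => ?_
    exact (isUnit_iff_isUnit_det _).1 isUnit_one.neg
  have h1 := associated_unit_mul_left (comp _ _ _ _ R (cyclicMatrix m)).det _ hs
  rw [← hsign, hperm] at h1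
  exact h1.symm.trans (associated_mul_unit_left _ _ hm)

end LinearAlgebra

/-! ### The Alexander matrix of a positive braid -/

section AlexanderMatrix

open Matrix LaurentPolynomial

/-- The unreduced Burau matrix of the positive generator `σⱼ`: the upper meridians at the
crossing, in the abelianized Fox calculus, in terms of the lower ones. -/
noncomputable def burauMatrix {n : ℕ} (j : Fin (n - 1)) : Matrix (Fin n) (Fin n) ℤ[T;T⁻¹] :=
  of fun i i' =>
    if (i : ℕ) = j then
      (if (i' : ℕ) = j then 1 - T 1 else 0) + (if (i' : ℕ) = j + 1 then T 1 else 0)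
    else if (i : ℕ) = j + 1 then (if (i' : ℕ) = j then 1 else 0)
    else if i' = i then 1 else 0

/-- The Burau matrices of the levels of a positive closed braid; the last level, which closes
the braid up, has the identity matrix. -/
noncomputable def levelMatrix {n : ℕ} (β : BraidWord n) (k : Fin (β.length + 1)) :
    Matrix (Fin n) (Fin n) ℤ[T;T⁻¹] :=
  if hk : (k : ℕ) < β.length then burauMatrix (β[(k : ℕ)]).1 else 1

lemma foxDerivative_mul_inv {ι : Type*} [DecidableEq ι] (x a u : ι) :
    foxDerivative x [(a, true), (u, false)]
      = (if a = x then 1 else 0) - (if u = x then 1 else 0) := by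
  have hT : (T 1 * T (-1) : ℤ[T;T⁻¹]) = 1 := by rw [← T_add]; simp
  simp only [foxDerivative, mul_zero, add_zero, mul_ite, mul_neg, hT]
  split_ifs <;> ring

lemma foxDerivative_conj_mul_inv {ι : Type*} [DecidableEq ι] (x a b u : ι) :
    foxDerivative x [(a, true), (b, true), (a, false), (u, false)]
      = (if a = x then 1 - T 1 else 0) + (if b = x then T 1 else 0)
        - (if u = x then 1 else 0) := by
  have hT : (T 1 * T (-1) : ℤ[T;T⁻¹]) = 1 := by rw [← T_add]; simp
  simp only [foxDerivative, mul_zero, add_zero]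
  have e : ∀ y : ι, (if y = x then -T (-1) else 0 : ℤ[T;T⁻¹])
      = -T (-1) * (if y = x then 1 else 0) := by intro y; split_ifs <;> simp
  have e1 : (if a = x then 1 - T 1 else 0 : ℤ[T;T⁻¹]) = (1 - T 1) * (if a = x then 1 else 0) := by
    split_ifs <;> simp
  have e2 : (if b = x then T 1 else 0 : ℤ[T;T⁻¹]) = T 1 * (if b = x then 1 else 0) := by
    split_ifs <;> simp
  rw [e, e, e1, e2]
  linear_combination (-(T 1 * (if a = x then 1 else 0)) -
    (T 1 * T (-1) + 1) * (if u = x then 1 else 0)) * hT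

lemma alexanderMatrix_wirtingerRelator {n : ℕ} (β : BraidWord n) (hβ : ∀ l ∈ β, l.2 = true) :
    alexanderMatrix β.wirtingerRelator
      = comp _ _ _ _ _ (cyclicMatrix (levelMatrix β)) := by
  ext1 ⟨k, i⟩ ⟨k', i'⟩
  have hI : (if k' = k + 1 ∧ i = i' then 1 else 0 : ℤ[T;T⁻¹])
      = if ((k + 1, i) : β.Edge) = (k', i') then 1 else 0 := by
    simp only [Prod.mk.injEq, eq_comm (a := k')]
  rw [comp_cyclicMatrix_apply, hI]
  simp only [alexanderMatrix, of_apply, levelMatrix, BraidWord.wirtingerRelator]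
  by_cases hk : (k : ℕ) < β.length
  · have hpos := hβ _ (List.getElem_mem hk)
    have hup : (⟨(k : ℕ) + 1, by omega⟩ : Fin (β.length + 1)) = k + 1 := by
      ext
      rw [Fin.val_add_one_of_lt' (by omega)]
    simp only [hk, dif_pos, hpos, if_true, hup]
    by_cases h1 : (i : ℕ) = (β[(k : ℕ)]).1
    · rw [if_pos h1, foxDerivative_conj_mul_inv]
      congr 1
      by_cases hkk : k' = k
      · subst hkk
        simp [burauMatrix, h1, Fin.ext_iff, eq_comm]
      · simp [hkk, Ne.symm hkk]
    · rw [if_neg h1]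
      by_cases h2 : (i : ℕ) = (β[(k : ℕ)]).1 + 1
      · rw [if_pos h2, foxDerivative_mul_inv]
        congr 1
        by_cases hkk : k' = k
        · subst hkk
          simp [burauMatrix, h2, Fin.ext_iff, eq_comm]
        · simp [hkk, Ne.symm hkk]
      · rw [if_neg h2, foxDerivative_mul_inv]
        congr 1
        by_cases hkk : k' = k
        · subst hkk
          simp [burauMatrix, h1, h2, eq_comm]
        · simp [hkk, Ne.symm hkk]
  · have hlast : k + 1 = 0 := by
      have : k = Fin.last _ := Fin.ext (by simp; omega)
      rw [this, Fin.last_add_one]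
    simp only [hk, dif_neg, not_false_iff, foxDerivative_mul_inv, hlast]
    congr 1
    by_cases hkk : k' = k
    · subst hkk
      simp [Matrix.one_apply]
    · simp [hkk, Ne.symm hkk]

lemma burauMatrix_mulVec_apply {n : ℕ} (j : Fin (n - 1)) (x : Fin n → ℤ[T;T⁻¹]) (i : Fin n) :
    (burauMatrix j *ᵥ x) i =
      if (i : ℕ) = j then (1 - T 1) * x ⟨j, by omega⟩ + T 1 * x ⟨j + 1, by omega⟩
      else if (i : ℕ) = j + 1 then x ⟨j, by omega⟩ else x i := by
  have h1 : ∀ i' : Fin n, (i' : ℕ) = j ↔ i' = ⟨j, by omega⟩ := fun i' => by simp [Fin.ext_iff]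
  have h2 : ∀ i' : Fin n, (i' : ℕ) = j + 1 ↔ i' = ⟨j + 1, by omega⟩ := fun i' => by
    simp [Fin.ext_iff]
  simp only [mulVec, dotProduct, burauMatrix, of_apply]
  split_ifs
  · simp [h1, h2, add_mul, Finset.sum_add_distrib]
  · simp [h1]
  · simp

lemma burauMatrix_mulVec_one {n : ℕ} (j : Fin (n - 1)) : burauMatrix j *ᵥ 1 = 1 := by
  ext1 i
  rw [burauMatrix_mulVec_apply]
  split_ifs <;> simp

lemma vecMul_burauMatrix {n : ℕ} (j : Fin (n - 1)) :
    (fun i : Fin n => (T (i : ℕ) : ℤ[T;T⁻¹])) ᵥ* burauMatrix j = fun i : Fin n => T (i : ℕ) := by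
  have h1 : ∀ i' : Fin n, (i' : ℕ) = j ↔ i' = ⟨j, by omega⟩ := fun i' => by simp [Fin.ext_iff]
  have h2 : ∀ i' : Fin n, (i' : ℕ) = j + 1 ↔ i' = ⟨j + 1, by omega⟩ := fun i' => by
    simp [Fin.ext_iff]
  ext1 i'
  have h3 : ∀ i : Fin n, (burauMatrix j i i' : ℤ[T;T⁻¹]) =
      (if i = ⟨j, by omega⟩ then
        (if (i' : ℕ) = j then 1 - T 1 else 0) + (if (i' : ℕ) = j + 1 then T 1 else 0) else 0)
      + (if i = ⟨j + 1, by omega⟩ then (if (i' : ℕ) = j then 1 else 0) else 0)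
      + (if i = i' then (if (i' : ℕ) = j ∨ (i' : ℕ) = j + 1 then 0 else 1) else 0) := fun i => by
    simp only [burauMatrix, of_apply, Fin.ext_iff]
    split_ifs <;> first | omega | simp
  simp only [vecMul, dotProduct, h3, mul_add, Finset.sum_add_distrib, mul_ite, mul_zero,
    Finset.sum_ite_eq', Finset.mem_univ, if_true]
  have hT : (T ((j : ℤ) + 1) : ℤ[T;T⁻¹]) = T j * T 1 := T_add _ _
  by_cases ha : (i' : ℕ) = j
  · simp [ha, hT, -T_mul]; ring
  · by_cases hb : (i' : ℕ) = j + 1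
    · simp [hb, hT, -T_mul]
    · simp [ha, hb]

end AlexanderMatrix

/-! ### Elimination for closed positive braids -/

section ClosedBraid

open Matrix LaurentPolynomial

/-- The unreduced Burau matrix of a positive braid word: it expresses the meridians at the top of
the braid in terms of those at the bottom, so that the letters act from right to left. -/
noncomputable def braidMatrix {n : ℕ} (β : BraidWord n) : Matrix (Fin n) (Fin n) ℤ[T;T⁻¹] :=
  (β.map fun l => burauMatrix l.1).reverse.prod

lemma braidMatrix_nil {n : ℕ} : braidMatrix ([] : BraidWord n) = 1 := rfl

lemma braidMatrix_cons {n : ℕ} (l : Fin (n - 1) × Bool) (β : BraidWord n) :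
    braidMatrix (l :: β) = braidMatrix β * burauMatrix l.1 := by
  simp [braidMatrix]

lemma braidMatrix_append {n : ℕ} (β γ : BraidWord n) :
    braidMatrix (β ++ γ) = braidMatrix γ * braidMatrix β := by
  simp [braidMatrix]

lemma braidMatrix_mulVec_one {n : ℕ} (β : BraidWord n) : braidMatrix β *ᵥ 1 = 1 := by
  induction β with
  | nil => simp [braidMatrix_nil]
  | cons l β ih => rw [braidMatrix_cons, ← mulVec_mulVec, burauMatrix_mulVec_one, ih]

lemma levelMatrix_mulVec_one {n : ℕ} (β : BraidWord n) (k : Fin (β.length + 1)) :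
    levelMatrix β k *ᵥ 1 = 1 := by
  unfold levelMatrix
  split_ifs
  · exact burauMatrix_mulVec_one _
  · simp

lemma vecMul_levelMatrix {n : ℕ} (β : BraidWord n) (k : Fin (β.length + 1)) :
    (fun i : Fin n => (T (i : ℕ) : ℤ[T;T⁻¹])) ᵥ* levelMatrix β k = fun i : Fin n => T (i : ℕ) := by
  unfold levelMatrix
  split_ifs
  · exact vecMul_burauMatrix _
  · simp

lemma braidMatrix_drop {n : ℕ} (β : BraidWord n) (k : Fin (β.length + 1)) :
    braidMatrix (β.drop k) = braidMatrix (β.drop (k + 1)) * levelMatrix β k := by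
  unfold levelMatrix
  split_ifs with hk
  · rw [List.drop_eq_getElem_cons hk, braidMatrix_cons]
  · rw [List.drop_eq_nil_of_le (by omega), List.drop_eq_nil_of_le (by omega), mul_one]

lemma comp_cyclicMatrix_mulVec_one {n : ℕ} (β : BraidWord n) :
    comp _ _ _ _ _ (cyclicMatrix (levelMatrix β)) *ᵥ 1 = 0 := by
  ext1 ⟨k, i⟩
  have h := congrFun (levelMatrix_mulVec_one β k) i
  simp only [mulVec, dotProduct, Pi.one_apply, mul_one] at h
  simp only [mulVec, dotProduct, Pi.one_apply, mul_one, Pi.zero_apply, comp_cyclicMatrix_apply,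
    Fintype.sum_prod_type, Finset.sum_sub_distrib, ite_and]
  rw [Finset.sum_comm, Finset.sum_comm (γ := Fin n)]
  simp [h]

lemma vecMul_comp_cyclicMatrix {n : ℕ} (β : BraidWord n) :
    (fun e : β.Edge => (T (e.2 : ℕ) : ℤ[T;T⁻¹])) ᵥ*
      comp _ _ _ _ _ (cyclicMatrix (levelMatrix β)) = 0 := by
  ext1 ⟨k, i⟩
  have h := congrFun (vecMul_levelMatrix β k) i
  have hsucc : ∀ k' : Fin (β.length + 1), k = k' + 1 ↔ k' = k - 1 := fun k' => by
    rw [eq_sub_iff_add_eq, eq_comm]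
  simp only [vecMul, dotProduct] at h
  simp only [vecMul, dotProduct, Pi.zero_apply, comp_cyclicMatrix_apply, Fintype.sum_prod_type,
    mul_sub, Finset.sum_sub_distrib, hsucc, ite_and]
  rw [Finset.sum_comm, Finset.sum_comm (γ := Fin n)]
  simp [h, -T_mul]

/-- The first elementary ideal of a closed positive braid is generated by an element `c` such that
`c (1 + t + ⋯ + t ^ (n - 1)) ∑ v` is, up to units, the determinant of `B + 1 vᵀ - 1` for every `v`,
where `B` is the unreduced Burau matrix. -/
lemma exists_firstElementaryIdeal_eq_span {n : ℕ} (hn : 0 < n) (β : BraidWord n)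
    (hβ : ∀ l ∈ β, l.2 = true) :
    ∃ c : ℤ[T;T⁻¹], firstElementaryIdeal (alexanderMatrix β.wirtingerRelator) = Ideal.span {c} ∧
      ∀ v : Fin n → ℤ[T;T⁻¹],
        Associated (c * ((∑ i : Fin n, T (i : ℕ)) * ∑ i, v i))
          (braidMatrix β + vecMulVec 1 v - 1).det := by
  let e : β.Edge := (0, ⟨0, hn⟩)
  have hA := comp_cyclicMatrix_mulVec_one β
  have hw := vecMul_comp_cyclicMatrix β
  refine ⟨(comp _ _ _ _ _ (cyclicMatrix (levelMatrix β))).adjugate e e, ?_, fun v => ?_⟩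
  · rw [alexanderMatrix_wirtingerRelator β hβ]
    exact firstElementaryIdeal_eq_span_singleton hA hw (fun _ => isUnit_T _) e e
  -- Perturb the first block of the Alexander matrix by `1 vᵀ`.
  let u : β.Edge → ℤ[T;T⁻¹] := fun x => if x.1 = 0 then 1 else 0
  let v' : β.Edge → ℤ[T;T⁻¹] := fun x => if x.1 = 0 then v x.2 else 0
  let m : Fin (β.length + 1) → Matrix (Fin n) (Fin n) ℤ[T;T⁻¹] := fun k =>
    if k = 0 then levelMatrix β 0 + vecMulVec 1 v else levelMatrix β k
  have h1 := det_add_vecMulVec_of_kernels hA hw e e (by simp [e]) u v'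
  have h2 : comp _ _ _ _ _ (cyclicMatrix (levelMatrix β)) + vecMulVec u v'
      = comp _ _ _ _ _ (cyclicMatrix m) := by
    ext1 ⟨k, i⟩ ⟨k', i'⟩
    simp only [comp_cyclicMatrix_apply, Matrix.add_apply, vecMulVec_apply, u, v', m]
    by_cases hk : k = 0
    · subst hk
      by_cases hk' : k' = 0
      · subst hk'
        simp
        ring
      · simp [hk']
    · simp [hk]
  have h3 : (fun x : β.Edge => (T (x.2 : ℕ) : ℤ[T;T⁻¹])) ⬝ᵥ u = ∑ i : Fin n, T (i : ℕ) := by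
    simp only [dotProduct, Fintype.sum_prod_type, u]
    rw [Finset.sum_comm]
    simp
  have h4 : ∑ x, v' x = ∑ i, v i := by
    simp only [Fintype.sum_prod_type, v']
    rw [Finset.sum_comm]
    simp
  rw [h2, h3, h4] at h1
  rw [← h1]
  let N : ℕ → Matrix (Fin n) (Fin n) ℤ[T;T⁻¹] := fun k =>
    if k = 0 then braidMatrix β + vecMulVec 1 v else braidMatrix (β.drop k)
  refine associated_det_cyclicMatrix m N (fun k => ?_) ?_
  · by_cases hk : k = 0
    · subst hk
      have := braidMatrix_drop β 0
      simp only [Fin.val_zero, List.drop_zero, zero_add] at this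
      have h5 : braidMatrix (β.drop 1) * vecMulVec 1 v = vecMulVec 1 v := by
        rw [mul_vecMulVec, braidMatrix_mulVec_one]
      simp only [N, m, Fin.val_zero, zero_add, one_ne_zero, if_true, if_false, mul_add, h5, ← this]
    · have hk' : (k : ℕ) ≠ 0 := fun h => hk (Fin.ext h)
      simp [N, m, hk, braidMatrix_drop]
  · simp [N, List.drop_eq_nil_of_le, braidMatrix_nil]

end ClosedBraid

/-! ### The Burau matrix of a torus braid -/

section TorusBraid

open Matrix LaurentPolynomial

variable {n : ℕ}

/-- The cyclic shift `(S x) i = x (i + 1)` of the `n + 1` strands. -/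
def shiftMatrix (R : Type*) [CommRing R] (n : ℕ) : Matrix (Fin (n + 1)) (Fin (n + 1)) R :=
  of fun i i' => if i' = i + 1 then 1 else 0

section Shift

variable {R : Type*} [CommRing R]

lemma shiftMatrix_mulVec_apply (x : Fin (n + 1) → R) (i : Fin (n + 1)) :
    (shiftMatrix R n *ᵥ x) i = x (i + 1) := by
  simp [shiftMatrix, mulVec, dotProduct]

lemma shiftMatrix_pow_mulVec_apply (m : ℕ) (x : Fin (n + 1) → R) (i : Fin (n + 1)) :
    (shiftMatrix R n ^ m *ᵥ x) i = x (i + m • 1) := by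
  induction m generalizing i with
  | zero => simp
  | succ m ih =>
    rw [pow_succ', ← mulVec_mulVec, shiftMatrix_mulVec_apply, ih]
    rw [succ_nsmul', add_assoc]

lemma shiftMatrix_pow_card : shiftMatrix R n ^ (n + 1) = 1 := by
  refine ext_of_mulVec_single fun j => ?_
  ext i
  have h : (n + 1) • (1 : Fin (n + 1)) = 0 := by
    simpa using card_nsmul_eq_zero (x := (1 : Fin (n + 1)))
  rw [shiftMatrix_pow_mulVec_apply, h]
  simp [Matrix.one_apply, Pi.single_apply]

lemma isUnit_det_shiftMatrix : IsUnit (shiftMatrix R n).det := by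
  refine (isUnit_iff_isUnit_det _).1 (IsUnit.of_pow_eq_one shiftMatrix_pow_card (by omega))

lemma associated_det_smul_sub_shiftMatrix (x : R) :
    Associated (x • (1 : Matrix (Fin (n + 1)) (Fin (n + 1)) R) - shiftMatrix R n).det
      (x ^ (n + 1) - 1) := by
  let m : Fin (n + 1) → Matrix Unit Unit R := fun _ => x • 1
  have h := associated_det_cyclicMatrix m (fun k => x ^ (n + 1 - k) • 1)
    (fun k => by
      have : n + 1 - (k : ℕ) = n + 1 - (k + 1) + 1 := by omega
      simp only [m, this, smul_mul_smul_comm, mul_one, pow_succ])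
    (by simp)
  have h1 : (comp _ _ _ _ R (cyclicMatrix m)).det
      = (x • (1 : Matrix (Fin (n + 1)) (Fin (n + 1)) R) - shiftMatrix R n).det := by
    rw [← det_submatrix_equiv_self (Equiv.prodPUnit (Fin (n + 1))).symm]
    congr 1
    ext i j
    simp only [submatrix_apply, Equiv.prodPUnit_symm_apply, comp_cyclicMatrix_apply, m]
    simp [shiftMatrix, Matrix.one_apply, eq_comm]
  rw [h1] at h
  simpa using h

/-- The eigenvalues of the cyclic shift are the roots of unity of order `n + 1`. -/
lemma associated_det_smul_shiftMatrix_sub_one (x : R) :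
    Associated (x • shiftMatrix R n - 1).det (x ^ (n + 1) - 1) := by
  set S := shiftMatrix R n with hS
  have h1 : S * Sᵀ = 1 := by
    ext i j
    simp [hS, shiftMatrix, mul_apply, Matrix.one_apply, eq_comm]
  have h2 : x • S - 1 = S * (x • 1 - S)ᵀ := by
    rw [transpose_sub, mul_sub, h1]
    simp
  rw [h2, det_mul, det_transpose]
  exact (associated_unit_mul_left _ _ isUnit_det_shiftMatrix).trans
    (associated_det_smul_sub_shiftMatrix x)

end Shift

/-- One round `σ₀ σ₁ ⋯ σ_{n-1}` of the torus braid. -/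
abbrev torusRound (n : ℕ) : BraidWord (n + 1) := (List.finRange n).map fun i => (i, true)

lemma braidMatrix_take_torusRound_mulVec (x : Fin (n + 1) → ℤ[T;T⁻¹]) (m : ℕ) (hm : m ≤ n)
    (i : Fin (n + 1)) : (braidMatrix ((torusRound n).take m) *ᵥ x) i =
      if (i : ℕ) < m then (1 - T 1) * x 0 + T 1 * x (i + 1)
      else if (i : ℕ) = m then x 0 else x i := by
  induction m generalizing i with
  | zero =>
    simp only [List.take_zero, braidMatrix_nil, one_mulVec, Nat.not_lt_zero, if_false]
    split_ifs with h
    · rw [Fin.ext (a := i) (b := 0) h]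
    · rfl
  | succ m ih =>
    have h1 : (torusRound n).take (m + 1)
        = (torusRound n).take m ++ ([((⟨m, hm⟩ : Fin n), true)] : BraidWord (n + 1)) := by
      rw [List.take_succ_eq_append_getElem (by simpa using hm)]
      simp [torusRound]
    rw [h1, braidMatrix_append, braidMatrix_cons, braidMatrix_nil, one_mul, ← mulVec_mulVec,
      burauMatrix_mulVec_apply]
    simp only [ih (by omega)]
    by_cases h2 : (i : ℕ) = m
    · have h3 : (⟨m + 1, by omega⟩ : Fin (n + 1)) = i + 1 := by
        ext; rw [Fin.val_add_one_of_lt' (by omega), h2]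
      simp [h2, h3]
    · by_cases h3 : (i : ℕ) = m + 1
      · simp [h3]
      · have h4 : (i : ℕ) < m + 1 ↔ (i : ℕ) < m := by omega
        simp [h2, h3, h4]

/-- One round of the torus braid shifts the strands cyclically, multiplying by `t`, up to a
matrix with constant columns. -/
lemma braidMatrix_torusRound :
    braidMatrix (torusRound n)
      = (T 1 : ℤ[T;T⁻¹]) • shiftMatrix ℤ[T;T⁻¹] n + vecMulVec 1 (Pi.single 0 (1 - T 1) : Fin (n + 1) → ℤ[T;T⁻¹]) := by
  refine ext_of_mulVec_single fun j => ?_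
  ext1 i
  have h := braidMatrix_take_torusRound_mulVec (Pi.single j 1) n le_rfl i
  rw [List.take_of_length_le (by simp)] at h
  rw [h, add_mulVec, Pi.add_apply, smul_mulVec, Pi.smul_apply, shiftMatrix_mulVec_apply,
    vecMulVec_mulVec]
  by_cases hi : (i : ℕ) < n
  · simp [hi, Pi.single_apply, eq_comm, -T_mul]
    ring
  · have h1 : i = Fin.last n := Fin.ext (by simp; omega)
    subst h1
    simp [Fin.last_add_one, Pi.single_apply, eq_comm, -T_mul]
    split_ifs <;> ring

lemma braidMatrix_torusBraid (q : ℕ) :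
    braidMatrix (torusBraid (n + 1) q) = braidMatrix (torusRound n) ^ q := by
  induction q with
  | zero => rfl
  | succ q ih =>
    rw [pow_succ, ← ih, ← braidMatrix_append]
    rfl

lemma shiftMatrix_pow_mulVec_one {R : Type*} [CommRing R] (m : ℕ) :
    shiftMatrix R n ^ m *ᵥ 1 = 1 := by
  ext i
  rw [shiftMatrix_pow_mulVec_apply]
  rfl

lemma exists_braidMatrix_torusRound_pow (m : ℕ) : ∃ r : Fin (n + 1) → ℤ[T;T⁻¹],
    braidMatrix (torusRound n) ^ m = (T m : ℤ[T;T⁻¹]) • shiftMatrix ℤ[T;T⁻¹] n ^ m + vecMulVec 1 r := by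
  induction m with
  | zero => exact ⟨0, by simp⟩
  | succ m ih =>
    obtain ⟨r, hr⟩ := ih
    refine ⟨(T m : ℤ[T;T⁻¹]) • Pi.single 0 (1 - T 1) + r ᵥ* braidMatrix (torusRound n), ?_⟩
    rw [pow_succ, hr, add_mul, vecMulVec_mul]
    nth_rewrite 1 [braidMatrix_torusRound]
    rw [mul_add, smul_mul_smul_comm, ← pow_succ, smul_mul_assoc, mul_vecMulVec,
      shiftMatrix_pow_mulVec_one, vecMulVec_add, vecMulVec_smul, add_assoc]
    congr 2
    rw [← T_add]
    simp

/-- The classical formula for the Alexander polynomial of a torus knot, with denominators cleared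
and up to units. -/
lemma exists_generator_torusBraid : ∃ c : ℤ[T;T⁻¹],
    firstElementaryIdeal (alexanderMatrix (torusBraid (n + 1) (n + 2)).wirtingerRelator)
      = Ideal.span {c} ∧
    Associated (c * ((∑ i : Fin (n + 1), T (i : ℕ)) * (T ((n + 2 : ℕ) : ℤ) - 1)))
      (T ((n + 2 : ℕ) : ℤ) ^ (n + 1) - 1) := by
  have hpos : ∀ l ∈ torusBraid (n + 1) (n + 2), l.2 = true := by
    intro l hl
    simp only [torusBraid, List.mem_flatten, List.mem_replicate] at hl
    obtain ⟨_, ⟨_, rfl⟩, hl⟩ := hl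
    simp only [List.mem_map] at hl
    obtain ⟨_, _, rfl⟩ := hl
    rfl
  obtain ⟨c, hc, h⟩ := exists_firstElementaryIdeal_eq_span (Nat.succ_pos n) _ hpos
  obtain ⟨r, hr⟩ := exists_braidMatrix_torusRound_pow (n := n) (n + 2)
  have hS : shiftMatrix ℤ[T;T⁻¹] n ^ (n + 2) = shiftMatrix _ n := by
    rw [pow_succ, shiftMatrix_pow_card, one_mul]
  have hsum : ∑ i, -r i = T ((n + 2 : ℕ) : ℤ) - 1 := by
    have h1 := congrFun (braidMatrix_mulVec_one (torusBraid (n + 1) (n + 2))) 0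
    rw [braidMatrix_torusBraid, hr, add_mulVec, smul_mulVec, shiftMatrix_pow_mulVec_one,
      vecMulVec_mulVec] at h1
    simp [dotProduct] at h1
    rw [Finset.sum_neg_distrib, ← h1]
    push_cast
    ring
  refine ⟨c, hc, ?_⟩
  -- Perturbing by `-r` cancels the part of the Burau matrix with constant columns.
  have h2 := h (fun i => - r i)
  rw [hsum, braidMatrix_torusBraid, hr, hS] at h2
  have h3 : (T ((n + 2 : ℕ) : ℤ) : ℤ[T;T⁻¹]) • shiftMatrix ℤ[T;T⁻¹] n + vecMulVec 1 r + vecMulVec 1 (fun i => -r i) - 1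
      = (T ((n + 2 : ℕ) : ℤ) : ℤ[T;T⁻¹]) • shiftMatrix ℤ[T;T⁻¹] n - 1 := by
    have : (fun i => -r i) = -r := rfl
    rw [this, vecMulVec_neg]
    abel
  rw [h3] at h2
  exact h2.trans (associated_det_smul_shiftMatrix_sub_one _)

end TorusBraid

/-! ### Normalization of Laurent polynomials -/

section Normalization

open LaurentPolynomial

lemma exists_eq_C_mul_T_of_isUnit {R : Type*} [CommRing R] [IsDomain R] {u : R[T;T⁻¹]}
    (hu : IsUnit u) : ∃ (r : R) (n : ℤ), u = C r * T n := by
  obtain ⟨v, hv⟩ := hu.exists_right_inv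
  obtain ⟨a, f, hf⟩ := exists_T_pow u
  obtain ⟨b, g, hg⟩ := exists_T_pow v
  have h1 : f * g = Polynomial.X ^ (a + b) := by
    apply Polynomial.toLaurent_injective
    rw [map_mul, hf, hg, Polynomial.toLaurent_X_pow, Nat.cast_add, T_add]
    linear_combination (T a * T b) * hv
  obtain ⟨i, -, w, hw⟩ := (dvd_prime_pow Polynomial.prime_X _).1 (Dvd.intro _ h1)
  obtain ⟨r, -, hr⟩ := Polynomial.isUnit_iff.1 w⁻¹.isUnit
  refine ⟨r, i - a, ?_⟩
  have h2 : f = Polynomial.X ^ i * Polynomial.C r := by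
    rw [hr, ← hw, Units.mul_inv_cancel_right]
  have h3 : u = Polynomial.toLaurent f * T (-a) := by rw [hf, mul_assoc, ← T_add]; simp
  rw [h3, h2, map_mul, Polynomial.toLaurent_X_pow, Polynomial.toLaurent_C, T_sub]
  ring

/-- Symmetry and the value `1` at `1` single out at most one Laurent polynomial in each class of
associates. -/
lemma eq_of_associated_of_invert_eq {f g : ℤ[T;T⁻¹]} (h : Associated f g)
    (hf : invert f = f) (hg : invert g = g)
    (hf1 : eval₂ (RingHom.id ℤ) 1 f = 1) (hg1 : eval₂ (RingHom.id ℤ) 1 g = 1) : f = g := by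
  obtain ⟨u, rfl⟩ := h
  have hf0 : f ≠ 0 := by rintro rfl; simp at hf1
  obtain ⟨r, n, hu⟩ := exists_eq_C_mul_T_of_isUnit u.isUnit
  rw [map_mul, hf1, one_mul, hu, eval₂_C_mul_T] at hg1
  have hr : r = 1 := by simpa using hg1
  rw [map_mul, hf, hu, hr] at hg
  have hT := mul_left_cancel₀ hf0 hg
  have hn : n = 0 := by
    have := congrArg (fun x => x.coeff n) hT
    simp at this
    omega
  rw [hu, hr, hn]
  simp

end Normalization

/-! ### The Alexander polynomial of the torus knot -/

section TorusKnot

open LaurentPolynomial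

/-- The genus `n (n + 1) / 2` of the torus knot `T_{n+1,n+2}`. -/
def torusGenus (n : ℕ) : ℤ := (n * (n + 1) / 2 : ℕ)

lemma two_mul_torusGenus (n : ℕ) : 2 * torusGenus n = n * (n + 1) := by
  have := Nat.two_mul_div_two_of_even (Nat.even_mul_succ_self n)
  unfold torusGenus
  exact_mod_cast this

/-- The symmetrized Alexander polynomial of `T_{n+1,n+2}`. -/
noncomputable def torusAlexander (n : ℕ) : ℤ[T;T⁻¹] :=
  ∑ k ∈ Finset.range (n + 1), T (k * (n + 1) - torusGenus n)
    - ∑ k ∈ Finset.range n, T (k * (n + 2) + 1 - torusGenus n)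

lemma invert_torusAlexander (n : ℕ) : invert (torusAlexander n) = torusAlexander n := by
  have hg := two_mul_torusGenus n
  unfold torusAlexander
  rw [map_sub, map_sum, map_sum]
  congr 1
  · rw [← Finset.sum_range_reflect]
    refine Finset.sum_congr rfl fun k hk => ?_
    obtain ⟨j, rfl⟩ := Nat.exists_eq_add_of_le (Nat.lt_succ_iff.1 (Finset.mem_range.1 hk))
    have : k + j + 1 - 1 - k = j := by omega
    rw [invert_T, this]
    congr 1
    push_cast at hg ⊢
    linear_combination hg
  · rw [← Finset.sum_range_reflect]
    refine Finset.sum_congr rfl fun k hk => ?_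
    obtain ⟨j, rfl⟩ := Nat.exists_eq_add_of_lt (Finset.mem_range.1 hk)
    have : k + j + 1 - 1 - k = j := by omega
    rw [invert_T, this]
    congr 1
    push_cast at hg ⊢
    linear_combination hg

lemma eval₂_one_torusAlexander (n : ℕ) :
    eval₂ (RingHom.id ℤ) 1 (torusAlexander n) = 1 := by
  simp [torusAlexander]

/-- The product formula for the unsymmetrized Alexander polynomial, with denominators cleared. -/
lemma geom_sum_sub_mul_eq {R : Type*} [CommRing R] [IsDomain R] {t : R} (ht : t ≠ 1) (n : ℕ) :
    (∑ k ∈ Finset.range (n + 1), (t ^ (n + 1)) ^ k - t * ∑ k ∈ Finset.range n, (t ^ (n + 2)) ^ k)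
      * ((∑ k ∈ Finset.range (n + 1), t ^ k) * (t ^ (n + 2) - 1))
      = (t ^ (n + 2)) ^ (n + 1) - 1 := by
  refine mul_right_cancel₀ (sub_ne_zero.2 ht) ?_
  have hX := geom_sum_mul (t ^ (n + 1)) (n + 1)
  have hY := geom_sum_mul (t ^ (n + 2)) n
  have hZ := geom_sum_mul t (n + 1)
  set X := ∑ k ∈ Finset.range (n + 1), (t ^ (n + 1)) ^ k
  set Y := ∑ k ∈ Finset.range n, (t ^ (n + 2)) ^ k
  set Z := ∑ k ∈ Finset.range (n + 1), t ^ k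
  have h1 : (t ^ (n + 2)) ^ n * t = (t ^ (n + 1)) ^ (n + 1) := by ring
  have h2 : (t ^ (n + 2)) ^ (n + 1) = (t ^ (n + 1)) ^ (n + 1) * t ^ (n + 1) := by ring
  have h3 : t ^ (n + 2) = t ^ (n + 1) * t := by ring
  rw [h2]
  calc _ = (X * (t ^ (n + 1) - 1)) * (t ^ (n + 2) - 1)
        - t * (Y * (t ^ (n + 2) - 1)) * (t ^ (n + 1) - 1) := by
        linear_combination (X - t * Y) * (t ^ (n + 2) - 1) * hZ
    _ = _ := by
        rw [hX, hY, h3]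
        rw [h3] at h1
        linear_combination (-(t ^ (n + 1) - 1)) * h1

lemma T_mul_torusAlexander (n : ℕ) :
    T (torusGenus n) * torusAlexander n
      = ∑ k ∈ Finset.range (n + 1), ((T 1 : ℤ[T;T⁻¹]) ^ (n + 1)) ^ k
        - T 1 * ∑ k ∈ Finset.range n, (T 1 ^ (n + 2)) ^ k := by
  unfold torusAlexander
  rw [mul_sub, Finset.mul_sum, Finset.mul_sum, Finset.mul_sum]
  simp only [T_pow, ← T_add]
  congr 1 <;>
  · refine Finset.sum_congr rfl fun k _ => ?_
    congr 1
    push_cast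
    ring

lemma firstElementaryIdeal_torusBraid (n : ℕ) :
    firstElementaryIdeal (alexanderMatrix (torusBraid (n + 1) (n + 2)).wirtingerRelator)
      = Ideal.span {torusAlexander n} := by
  obtain ⟨c, hc, h⟩ := exists_generator_torusBraid (n := n)
  have hT : ∀ k : ℕ, (T k : ℤ[T;T⁻¹]) = T 1 ^ k := fun k => by rw [T_pow, mul_one]
  have ht : (T 1 : ℤ[T;T⁻¹]) ≠ 1 := fun h => by
    have := congrArg (fun x => x.coeff 0) h
    rw [← T_zero] at this
    simp at this
  have hne : (T 1 ^ (n + 2)) ^ (n + 1) - 1 ≠ (0 : ℤ[T;T⁻¹]) := fun h => by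
    rw [← pow_mul, ← hT, sub_eq_zero, ← T_zero] at h
    have := congrArg (fun x => x.coeff 0) h
    simp at this
    omega
  have key := geom_sum_sub_mul_eq ht n
  rw [← T_mul_torusAlexander] at key
  rw [Fin.sum_univ_eq_sum_range (fun i => (T (i : ℕ) : ℤ[T;T⁻¹]))] at h
  simp only [hT] at h
  rw [← key] at h hne
  have h1 : Associated c (T (torusGenus n) * torusAlexander n) :=
    h.of_mul_right (Associated.refl _) (right_ne_zero_of_mul hne)
  rw [hc, Ideal.span_singleton_eq_span_singleton]
  exact h1.trans (associated_unit_mul_left _ _ (isUnit_T _))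

lemma isSymmetrizedAlexanderPolynomial_torusBraid_iff (n : ℕ) (Δ : ℤ[T;T⁻¹]) :
    BraidWord.IsSymmetrizedAlexanderPolynomial (torusBraid (n + 1) (n + 2)) Δ
      ↔ Δ = torusAlexander n := by
  unfold BraidWord.IsSymmetrizedAlexanderPolynomial
  rw [firstElementaryIdeal_torusBraid]
  constructor
  · rintro ⟨h1, h2, h3⟩
    exact (eq_of_associated_of_invert_eq (Ideal.span_singleton_eq_span_singleton.1 h1)
      (invert_torusAlexander n) h2 (eval₂_one_torusAlexander n) h3).symm
  · rintro rfl
    exact ⟨rfl, invert_torusAlexander n, eval₂_one_torusAlexander n⟩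

/-! ### Coefficients -/

lemma torusAlexander_coeff (n : ℕ) (i : ℤ) :
    (torusAlexander n).coeff i
      = ∑ k ∈ Finset.range (n + 1), (if (k * (n + 1) - torusGenus n : ℤ) = i then 1 else 0)
        - ∑ k ∈ Finset.range n, (if (k * (n + 2) + 1 - torusGenus n : ℤ) = i then 1 else 0) := by
  simp [torusAlexander]

/-- The exponent `l (n + 2) + 1` lies strictly between `l (n + 1)` and `(l + 1) (n + 1)`. -/
lemma torus_exponent_ne {n l : ℕ} (hl : l < n) (k : ℕ) : k * (n + 1) ≠ l * (n + 2) + 1 := by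
  intro h
  rcases le_or_gt k l with hkl | hkl
  · have := Nat.mul_le_mul_right (n + 1) hkl
    nlinarith
  · have := Nat.mul_le_mul_right (n + 1) hkl
    nlinarith

lemma torusAlexander_coeff_pos {n k : ℕ} (hk : k ≤ n) :
    (torusAlexander n).coeff (k * (n + 1) - torusGenus n) = 1 := by
  rw [torusAlexander_coeff, Finset.sum_eq_single k, Finset.sum_eq_zero]
  · simp
  · intro l hl
    refine if_neg fun h => torus_exponent_ne (Finset.mem_range.1 hl) k ?_
    zify
    linarith
  · intro l _ hlk
    refine if_neg fun h => hlk ?_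
    have : (l : ℤ) * (n + 1) = k * (n + 1) := by linarith
    exact_mod_cast mul_right_cancel₀ (by positivity) this
  · intro h
    exact absurd (Finset.mem_range.2 (Nat.lt_succ_of_le hk)) h

lemma torusAlexander_coeff_neg {n k : ℕ} (hk : k < n) :
    (torusAlexander n).coeff (k * (n + 2) + 1 - torusGenus n) = -1 := by
  rw [torusAlexander_coeff, Finset.sum_eq_zero, Finset.sum_eq_single k]
  · simp
  · intro l _ hlk
    refine if_neg fun h => hlk ?_
    have : (l : ℤ) * (n + 2) = k * (n + 2) := by linarith
    exact_mod_cast mul_right_cancel₀ (by positivity) this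
  · intro h
    exact absurd (Finset.mem_range.2 hk) h
  · intro l _
    refine if_neg fun h => torus_exponent_ne hk l ?_
    zify
    linarith

lemma exists_of_torusAlexander_coeff_ne_zero {n : ℕ} {i : ℤ}
    (hi : (torusAlexander n).coeff i ≠ 0) :
    (∃ k ≤ n, i = k * (n + 1) - torusGenus n) ∨
      ∃ k < n, i = k * (n + 2) + 1 - torusGenus n := by
  by_contra! h
  refine hi ?_
  rw [torusAlexander_coeff, Finset.sum_eq_zero, Finset.sum_eq_zero, sub_zero]
  · exact fun k hk => if_neg fun hki => h.2 k (Finset.mem_range.1 hk) hki.symm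
  · exact fun k hk => if_neg fun hki =>
      h.1 k (Nat.lt_succ_iff.1 (Finset.mem_range.1 hk)) hki.symm

lemma torusAlexander_coeff_zero (n : ℕ) : (torusAlexander n).coeff 0 = (-1) ^ n := by
  have hg := two_mul_torusGenus n
  rcases Nat.even_or_odd' n with ⟨m, hm | hm⟩
  · have h : (0 : ℤ) = m * (n + 1) - torusGenus n := by
      subst hm; push_cast at hg ⊢; linarith
    rw [h, torusAlexander_coeff_pos (by omega), Even.neg_one_pow ⟨m, by omega⟩]
  · have h : (0 : ℤ) = m * (n + 2) + 1 - torusGenus n := by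
      subst hm; push_cast at hg ⊢; linarith
    rw [h, torusAlexander_coeff_neg (by omega), Odd.neg_one_pow ⟨m, hm⟩]

lemma torusAlexander_coeff_alternate {n : ℕ} {i j : ℤ} (hij : i < j)
    (hi : (torusAlexander n).coeff i ≠ 0) (hj : (torusAlexander n).coeff j ≠ 0)
    (h : ∀ k, i < k → k < j → (torusAlexander n).coeff k = 0) :
    (torusAlexander n).coeff j = -(torusAlexander n).coeff i := by
  rcases exists_of_torusAlexander_coeff_ne_zero hi with ⟨k, hk, rfl⟩ | ⟨k, hk, rfl⟩ <;>
  rcases exists_of_torusAlexander_coeff_ne_zero hj with ⟨l, hl, rfl⟩ | ⟨l, hl, rfl⟩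
  · exfalso
    have hkl : k < l := by
      by_contra! hlk
      have : (l : ℤ) * (n + 1) ≤ k * (n + 1) := by gcongr
      linarith
    have hkn : (k : ℤ) + 1 ≤ n := by exact_mod_cast (by omega : k + 1 ≤ n)
    have hle : ((k : ℤ) + 1) * (n + 1) ≤ l * (n + 1) := by gcongr; exact_mod_cast hkl
    have := h (k * (n + 2) + 1 - torusGenus n) (by linarith) (by linarith)
    rw [torusAlexander_coeff_neg (by omega)] at this
    omega
  · rw [torusAlexander_coeff_pos hk, torusAlexander_coeff_neg hl]
  · rw [torusAlexander_coeff_neg hk, torusAlexander_coeff_pos hl]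
    rfl
  · exfalso
    have hkl : k < l := by
      by_contra! hlk
      have : (l : ℤ) * (n + 2) ≤ k * (n + 2) := by gcongr
      linarith
    have hkn : (k : ℤ) + 1 ≤ n := by exact_mod_cast (by omega : k + 1 ≤ n)
    have hkl' : (k : ℤ) + 1 ≤ l := by exact_mod_cast hkl
    have hle : ((k : ℤ) + 1) * (n + 1) ≤ l * (n + 1) := by gcongr
    have := h ((k + 1 : ℕ) * (n + 1) - torusGenus n) (by push_cast; linarith)
      (by push_cast; linarith)
    rw [torusAlexander_coeff_pos (by omega)] at this
    omega

/-- Twice the exponent of a nonzero term is a multiple of `n + 1` if the term is positive and of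
`n + 2` if it is negative, so that no such exponent lies strictly between `0` and `(n + 1) / 2`. -/
lemma torusAlexander_coeff_eq_zero {n : ℕ} {i : ℤ} (hi : 0 < i) (hin : 2 * i < n + 1) :
    (torusAlexander n).coeff i = 0 := by
  have hg := two_mul_torusGenus n
  by_contra h
  rcases exists_of_torusAlexander_coeff_ne_zero h with ⟨k, hk, rfl⟩ | ⟨k, hk, rfl⟩
  · have h1 : (0 : ℤ) < (2 * k - n) * (n + 1) := by linarith
    have h2 : (0 : ℤ) < 2 * k - n := pos_of_mul_pos_left h1 (by positivity)
    have h3 : (1 : ℤ) * (n + 1) ≤ (2 * k - n) * (n + 1) := by gcongr; omega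
    linarith
  · have h1 : (0 : ℤ) < (2 * k - n + 1) * (n + 2) := by linarith
    have h2 : (0 : ℤ) < 2 * k - n + 1 := pos_of_mul_pos_left h1 (by positivity)
    have h3 : (1 : ℤ) * (n + 2) ≤ (2 * k - n + 1) * (n + 2) := by gcongr; omega
    linarith

end TorusKnot

theorem propositionp (p : ℕ) (hp : 1 ≤ p) :
    (∃! Δ : ℤ[T;T⁻¹],
      BraidWord.IsSymmetrizedAlexanderPolynomial (torusBraid p (p + 1)) Δ) ∧
    ∀ Δ : ℤ[T;T⁻¹],
      BraidWord.IsSymmetrizedAlexanderPolynomial (torusBraid p (p + 1)) Δ →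
      Δ.coeff 0 = (-1) ^ (p + 1) ∧
      (∀ i : ℤ, Δ.coeff i ≠ 0 → Δ.coeff i = 1 ∨ Δ.coeff i = -1) ∧
      (∀ i j : ℤ, i < j → Δ.coeff i ≠ 0 → Δ.coeff j ≠ 0 →
        (∀ k : ℤ, i < k → k < j → Δ.coeff k = 0) → Δ.coeff j = -Δ.coeff i) ∧
      (∀ i : ℤ, 0 < i → (i : ℝ) < (p : ℝ) / 2 → Δ.coeff i = 0) := by
  obtain ⟨n, rfl⟩ := Nat.exists_eq_add_of_le' hp
  have hiff := isSymmetrizedAlexanderPolynomial_torusBraid_iff n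
  refine ⟨⟨torusAlexander n, (hiff _).2 rfl, fun Δ h => (hiff Δ).1 h⟩, fun Δ hΔ => ?_⟩
  obtain rfl := (hiff Δ).1 hΔ
  refine ⟨?_, fun i hi => ?_, fun i j hij hi hj h => torusAlexander_coeff_alternate hij hi hj h,
    fun i hi hip => torusAlexander_coeff_eq_zero hi ?_⟩
  · rw [torusAlexander_coeff_zero]
    ring
  · rcases exists_of_torusAlexander_coeff_ne_zero hi with ⟨k, hk, rfl⟩ | ⟨k, hk, rfl⟩
    · exact Or.inl (torusAlexander_coeff_pos hk)
    · exact Or.inr (torusAlexander_coeff_neg hk)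
  · have h : (2 * i : ℝ) < n + 1 := by push_cast at hip; linarith
    exact_mod_cast h
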